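/- Let $\alpha\ge 0$, $\sigma\ge 0$, let $\pi$ be a measure on $(0,\infty)$ with $\int_{(0,\infty)}(r\wedge r^2)\,\pi(dr)<\infty$, and let $$\psi(\lambda)=\alpha\lambda+\tfrac12\sigma^2\lambda^2+\int_{(0,\infty)}\left(e^{-\lambda r}-1+\lambda r\right)\pi(dr),\qquad \lambda\ge 0.$$ Assume that $\int^{\infty}\frac{d\lambda}{\psi(\lambda)}<\infty$, meaning that $\int_c^\infty \frac{d\lambda}{\psi(\lambda)}<\infty$ for some $c>0$ (with $1/0=\infty$). Let $Z=(Z_t)_{t\ge0}$, with laws $(P_x)_{x\ge0}$ and expectations $E_x$, be a continuous-state branching process with branching mechanism $\psi$. That is, $Z$ is a time-homogeneous strong Markov process with values in $[0,\infty)$ whose paths are right continuous with left limits, $P_x(Z_0=x)=1$, the state $0$ is absorbing, and for all $\lambda>0$, $t\ge0$ and $x\ge 0$ one has $E_x[e^{-\lambda Z_t}]=e^{-x u_t(\lambda)}$, where $u_t(\lambda)\ge 0$ solves $\partial_t u_t(\lambda)=-\psi(u_t(\lambda))$, $u_0(\lambda)=\lambda$. Let $\zeta=\inf\{t>0: Z_t=0\}$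 (with $\inf\emptyset=+\infty$) be the extinction time, and for $x>0$ let $G(x,\cdot)$ be the potential measure on $(0,\infty)$, given by $G(x,A)=\int_0^\infty P_x(Z_t\in A)\,dt$ for Borel sets $A\subset(0,\infty)$. Then the following five statements are equivalent: 1. $G(x,\cdot)$ is a finite measure on $(0,\infty)$ for some $x>0$; 2. $G(x,\cdot)$ is a finite measure on $(0,\infty)$ for all $x>0$; 3. $E_x[\zeta]<\infty$ for some $x>0$; 4. $E_x[\zeta]<\infty$ for all $x>0$; 5. $\int_{0+}\frac{u}{\psi(u)}\,du<\infty$, meaning that $\int_0^c\frac{u}{\psi(u)}\,du<\infty$ for some $c>0$. -/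

import Mathlib

open MeasureTheory ProbabilityTheory Set Filter Topology
open scoped NNReal ENNReal

/-- The characteristics `(α, σ, π)` of a branching mechanism: `α ∈ ℝ`, `σ ≥ 0`, and `π` a measure
carried by `(0, ∞)` with `∫ (r ∧ r²) π(dr) < ∞` (which makes it a Radon measure on `(0, ∞)`). -/
structure BranchingMechanism where
  α : ℝ
  σ : ℝ
  π : Measure ℝ
  σ_nonneg : 0 ≤ σ
  π_nonpos : π (Iic 0) = 0
  integrable_π : Integrable (fun r : ℝ => min r (r ^ 2)) π

/-- `ψ(l) = α l + σ² l² / 2 + ∫_{(0,∞)} (e^{-l r} - 1 + l r) π(dr)`, used for `l ≥ 0` only. -/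
noncomputable def BranchingMechanism.ψ (B : BranchingMechanism) (l : ℝ) : ℝ :=
  B.α * l + 1 / 2 * B.σ ^ 2 * l ^ 2 + ∫ r in Ioi (0 : ℝ), (Real.exp (-l * r) - 1 + l * r) ∂B.π

/-- The condition `∫^{+∞} 1/ψ(l) dl < ∞` (near infinity), with values in `[0, ∞]`, where
`1/0 = ∞`. -/
def BranchingMechanism.GreyCondition (B : BranchingMechanism) : Prop :=
  ∃ c : ℝ, 0 < c ∧ ∫⁻ l in Ioi c, (ENNReal.ofReal (B.ψ l))⁻¹ < ⊤

/-- The condition `∫_{0+} u/ψ(u) du < ∞` (near zero), with values in `[0, ∞]`. -/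
def BranchingMechanism.SmallIntegralFinite (B : BranchingMechanism) : Prop :=
  ∃ c : ℝ, 0 < c ∧ ∫⁻ u in Ioo 0 c, ENNReal.ofReal u / ENNReal.ofReal (B.ψ u) < ⊤

/-- `u t l = u_t(l)` is the nonnegative solution on `t ≥ 0` of
`∂u_t(l)/∂t = -ψ(u_t(l))`, `u_0(l) = l`, for each `l > 0`. -/
structure BranchingMechanism.IsLogLaplace (B : BranchingMechanism) (u : ℝ → ℝ → ℝ) : Prop where
  init : ∀ l, 0 < l → u 0 l = l
  nonneg : ∀ l, 0 < l → ∀ t, 0 ≤ t → 0 ≤ u t l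
  ode : ∀ l, 0 < l → ∀ t, 0 ≤ t →
    HasDerivWithinAt (fun s => u s l) (-B.ψ (u t l)) (Ici 0) t

/-- A continuous-state branching process with branching mechanism `ψ`: a time-homogeneous strong
Markov process `Z` on `[0, ∞)` with right continuous paths with left limits, the law `P x` being
that of the process started at `x`, for which `0` is absorbing and
`E_x[e^{-l Z_t}] = e^{-x u_t(l)}` for `l > 0`. -/
structure CBProcess (B : BranchingMechanism) (Ω : Type*) [MeasurableSpace Ω] where
  P : Kernel ℝ≥0 Ω
  isMarkovKernel : IsMarkovKernel P
  Z : ℝ≥0 → Ω → ℝ≥0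
  measurable_Z : ∀ t, Measurable (Z t)
  rightCont : ∀ ω t, ContinuousWithinAt (fun s => Z s ω) (Ici t) t
  leftLim : ∀ ω t, ∃ y : ℝ≥0, Tendsto (fun s => Z s ω) (𝓝[<] t) (𝓝 y)
  start : ∀ x, ∀ᵐ ω ∂P x, Z 0 ω = x
  absorbing : ∀ x, ∀ᵐ ω ∂P x, ∀ s t, s ≤ t → Z s ω = 0 → Z t ω = 0
  /-- The strong Markov property at stopping times of the filtration generated by `Z`:
  `P_x(A, τ < ∞, Z_{τ+s} ∈ S) = E_x[P_{Z_τ}(Z_s ∈ S); A, τ < ∞]` for `A ∈ ℱ_τ`. -/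
  strongMarkov : ∀ (τ : Ω → WithTop ℝ≥0)
    (hτ : IsStoppingTime (Filtration.natural Z fun t => (measurable_Z t).stronglyMeasurable) τ)
    (A : Set Ω), MeasurableSet[hτ.measurableSpace] A →
    ∀ (x s : ℝ≥0) (S : Set ℝ≥0), MeasurableSet S →
      P x {ω | ω ∈ A ∧ τ ω ≠ ⊤ ∧ Z ((τ ω).untopA + s) ω ∈ S} =
        ∫⁻ ω in {ω | ω ∈ A ∧ τ ω ≠ ⊤}, P (Z (τ ω).untopA ω) {ω' | Z s ω' ∈ S} ∂P x
  laplace : ∃ u : ℝ → ℝ → ℝ, B.IsLogLaplace u ∧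
    ∀ (x t : ℝ≥0) (l : ℝ), 0 < l →
      ∫ ω, Real.exp (-l * (Z t ω : ℝ)) ∂P x = Real.exp (-(x : ℝ) * u t l)

namespace CBProcess

variable {B : BranchingMechanism} {Ω : Type*} [MeasurableSpace Ω]

/-- A process with right continuous paths is jointly measurable. -/
theorem measurable_uncurry (C : CBProcess B Ω) :
    Measurable (fun p : ℝ≥0 × Ω => C.Z p.1 p.2) := by
  let d : ℕ → ℝ≥0 → ℝ≥0 := fun n t => (⌈t * (n + 1)⌉₊ : ℝ≥0) / (n + 1)
  have hge : ∀ n t, t ≤ d n t := by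
    intro n t
    have hn : (0 : ℝ≥0) < n + 1 := by positivity
    rw [le_div_iff₀ hn]
    exact Nat.le_ceil _
  have hle : ∀ n t, d n t ≤ t + 1 / (n + 1) := by
    intro n t
    have hn : (0 : ℝ≥0) < n + 1 := by positivity
    rw [div_le_iff₀ hn, add_mul, one_div, inv_mul_cancel₀ hn.ne']
    exact (Nat.ceil_lt_add_one (zero_le)).le
  have hd : ∀ t, Tendsto (fun n => d n t) atTop (𝓝[≥] t) := by
    intro t
    refine tendsto_nhdsWithin_iff.2 ⟨?_, Eventually.of_forall fun n => hge n t⟩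
    refine tendsto_of_tendsto_of_tendsto_of_le_of_le (g := fun _ => t)
      (h := fun n : ℕ => t + 1 / ((n : ℝ≥0) + 1)) tendsto_const_nhds ?_
      (fun n => hge n t) (fun n => hle n t)
    simpa using (tendsto_const_nhds (x := t)).add
      (tendsto_one_div_add_atTop_nhds_zero_nat (𝕜 := ℝ≥0))
  refine measurable_of_tendsto_metrizable
    (f := fun (n : ℕ) (p : ℝ≥0 × Ω) => C.Z (d n p.1) p.2) (fun n => ?_) ?_
  · have h1 : Measurable (fun q : ℕ × Ω => C.Z ((q.1 : ℝ≥0) / (n + 1)) q.2) :=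
      measurable_from_prod_countable_right fun k => C.measurable_Z ((k : ℝ≥0) / (n + 1))
    have h2 : Measurable (fun p : ℝ≥0 × Ω => ((⌈p.1 * (n + 1)⌉₊ : ℕ), p.2)) :=
      (Nat.measurable_ceil.comp (measurable_fst.mul_const _)).prodMk measurable_snd
    have h3 := h1.comp h2
    simp only [Function.comp_def] at h3
    exact h3
  · rw [tendsto_pi_nhds]
    intro p
    exact (C.rightCont p.2 p.1).tendsto.comp (hd p.1)

theorem measurable_prob (C : CBProcess B Ω) (x : ℝ≥0) {S : Set ℝ≥0} (hS : MeasurableSet S) :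
    Measurable (fun t : ℝ => C.P x {ω | C.Z t.toNNReal ω ∈ S}) := by
  have := C.isMarkovKernel
  have h : MeasurableSet {p : ℝ × Ω | C.Z p.1.toNNReal p.2 ∈ S} :=
    (C.measurable_uncurry.comp
      ((measurable_real_toNNReal.comp measurable_fst).prodMk measurable_snd)) hS
  exact measurable_measure_prodMk_left h

/-- The potential measure on `(0, ∞)`: `G(x, A) = ∫_0^∞ P_x(Z_t ∈ A) dt`. -/
noncomputable def potentialMeasure (C : CBProcess B Ω) (x : ℝ≥0) : Measure (Ioi (0 : ℝ≥0)) :=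
  Measure.ofMeasurable
    (fun A _ => ∫⁻ t in Ioi (0 : ℝ), C.P x {ω | C.Z t.toNNReal ω ∈ Subtype.val '' A})
    (by simp)
    (by
      intro f hf hd
      have hm : ∀ i, MeasurableSet (Subtype.val '' f i : Set ℝ≥0) := fun i =>
        MeasurableSet.subtype_image measurableSet_Ioi (hf i)
      rw [← lintegral_tsum fun i => (C.measurable_prob x (hm i)).aemeasurable]
      refine lintegral_congr fun t => ?_
      rw [← measure_iUnion]
      · congr 1
        ext ω
        simp only [image_iUnion, mem_iUnion, Set.mem_ofPred_eq]
      · intro i j hij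
        have h := (disjoint_image_iff Subtype.val_injective).2 (hd hij)
        exact h.preimage (C.Z t.toNNReal)
      · exact fun i => C.measurable_Z _ (hm i))

theorem potentialMeasure_apply (C : CBProcess B Ω) (x : ℝ≥0) {A : Set (Ioi (0 : ℝ≥0))}
    (hA : MeasurableSet A) : C.potentialMeasure x A =
      ∫⁻ t in Ioi (0 : ℝ), C.P x {ω | C.Z t.toNNReal ω ∈ Subtype.val '' A} :=
  Measure.ofMeasurable_apply A hA

/-- The extinction time `ζ = inf {t > 0 : Z_t = 0}`, with `inf ∅ = ∞`. -/
noncomputable def extinctionTime (C : CBProcess B Ω) (ω : Ω) : ℝ≥0∞ :=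
  ⨅ (t : ℝ≥0) (_ : 0 < t ∧ C.Z t ω = 0), (t : ℝ≥0∞)

/-- `E_x[ζ] ∈ [0, ∞]`. -/
noncomputable def expectedExtinctionTime (C : CBProcess B Ω) (x : ℝ≥0) : ℝ≥0∞ :=
  ∫⁻ ω, C.extinctionTime ω ∂C.P x

end CBProcess

/-! Everything reduces to the formula `E_x[ζ] = G(x, (0,∞)) = ∫_0^∞ (1 - e^{-xv}) / ψ(v) dv`. As `0`
is absorbing, `ζ` is the time spent in `(0,∞)`, so the first equality is Tonelli
(`expectedExtinctionTime_eq_potentialMeasure_univ`). For the second (`potentialMeasure_univ_eq`),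
`P_x(Z_t > 0)` is the increasing limit of `1 - e^{-x u_t(λ)}` as `λ → ∞`; integrating in `t` and
substituting `v = u_t(λ)`, `dv = -ψ(v) dt` (`IsLogLaplace.lintegral_comp`) gives the same integral
over `(0, λ)`, and monotone convergence does the rest. Near infinity the integrand is at most `1/ψ`,
which Grey's condition controls; near `0` it is comparable to `v/ψ(v)`, with constants depending on
`x`. Finiteness is therefore statement 5, whatever `x > 0` is. -/

namespace BranchingMechanism

/-! ### Integrability, monotonicity and positivity of `ψ` -/

variable (B : BranchingMechanism)

/-- The integrand `e^{-l r} - 1 + l r` of a branching mechanism is `π`-integrable on `(0, ∞)`. -/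
theorem integrableOn_exp_sub_one_add {l : ℝ} (hl : 0 ≤ l) :
    IntegrableOn (fun r : ℝ => Real.exp (-l * r) - 1 + l * r) (Ioi 0) B.π := by
  have hm : Measurable fun r : ℝ => Real.exp (-l * r) - 1 + l * r := by fun_prop
  -- The integrand is at most `l r` and at most `(l r)²`, so `l + l²` serves for both branches of
  -- `min r (r²)`.
  refine ((B.integrable_π.integrableOn (s := Ioi 0)).const_mul (l + l ^ 2)).mono'
    hm.aestronglyMeasurable ?_
  refine (ae_restrict_mem measurableSet_Ioi).mono fun r (hr : 0 < r) => ?_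
  have hlr : 0 ≤ l * r := mul_nonneg hl hr.le
  have h0 : 0 ≤ Real.exp (-l * r) - 1 + l * r := by
    linarith [Real.add_one_le_exp (-l * r)]
  rw [Real.norm_of_nonneg h0]
  have h1 : Real.exp (-l * r) ≤ 1 := Real.exp_le_one_iff.2 (by linarith)
  have h2 : Real.exp (-l * r) - 1 + l * r ≤ (l * r) ^ 2 := by
    have h3 : Real.exp (-l * r) * (1 + l * r) ≤ 1 := by
      have h4 : 1 + l * r ≤ Real.exp (l * r) := by linarith [Real.add_one_le_exp (l * r)]
      calc Real.exp (-l * r) * (1 + l * r) ≤ Real.exp (-l * r) * Real.exp (l * r) := by gcongr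
        _ = 1 := by rw [← Real.exp_add]; simp
    nlinarith
  rcases min_cases r (r ^ 2) with ⟨h, -⟩ | ⟨h, -⟩ <;> rw [h]
  · nlinarith [mul_nonneg (sq_nonneg l) hr.le]
  · nlinarith [mul_nonneg hl (sq_nonneg r)]

variable {B}

/-- Each term is monotone. For the integrand, with `d = (b - a) r`, the increment is `e^{-ar}(e^{-d}
- 1) + d ≥ d (1 - e^{-ar}) ≥ 0`. -/
theorem ψ_monotoneOn (hα : 0 ≤ B.α) : MonotoneOn B.ψ (Ici 0) := by
  intro a (ha : 0 ≤ a) b (hb : 0 ≤ b) hab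
  unfold ψ
  have hI : ∫ r in Ioi (0 : ℝ), (Real.exp (-a * r) - 1 + a * r) ∂B.π ≤
      ∫ r in Ioi (0 : ℝ), (Real.exp (-b * r) - 1 + b * r) ∂B.π := by
    refine setIntegral_mono_on (B.integrableOn_exp_sub_one_add ha)
      (B.integrableOn_exp_sub_one_add hb) measurableSet_Ioi fun r (hr : 0 < r) => ?_
    have hd : 0 ≤ (b - a) * r := mul_nonneg (sub_nonneg.2 hab) hr.le
    have h1 : Real.exp (-a * r) ≤ 1 :=
      Real.exp_le_one_iff.2 (by nlinarith [mul_nonneg ha hr.le])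
    have h2 : Real.exp (-b * r) = Real.exp (-a * r) * Real.exp (-((b - a) * r)) := by
      rw [← Real.exp_add]; ring_nf
    have h3 := Real.add_one_le_exp (-((b - a) * r))
    rw [h2]
    nlinarith [Real.exp_pos (-a * r), mul_le_mul_of_nonneg_left h3 (Real.exp_pos (-a * r)).le,
      mul_nonneg hd (sub_nonneg.2 h1)]
  gcongr

theorem ψ_zero : B.ψ 0 = 0 := by simp [ψ]

theorem ψ_nonneg (hα : 0 ≤ B.α) {l : ℝ} (hl : 0 ≤ l) : 0 ≤ B.ψ l :=
  B.ψ_zero.symm.le.trans (ψ_monotoneOn hα self_mem_Ici hl hl)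

/-- If `ψ` vanishes at one positive point, then it vanishes identically. -/
theorem ψ_eq_zero_of_eq_zero (hα : 0 ≤ B.α) {l : ℝ} (hl : 0 < l) (h : B.ψ l = 0) (m : ℝ) :
    B.ψ m = 0 := by
  have hpos : ∀ r ∈ Ioi (0 : ℝ), 0 < Real.exp (-l * r) - 1 + l * r := fun r (hr : 0 < r) => by
    have := Real.add_one_lt_exp (x := -l * r) (by nlinarith [mul_pos hl hr])
    linarith
  have hI0 : 0 ≤ ∫ r in Ioi (0 : ℝ), (Real.exp (-l * r) - 1 + l * r) ∂B.π :=
    setIntegral_nonneg measurableSet_Ioi fun r hr => (hpos r hr).le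
  have h1 : 0 ≤ B.α * l := mul_nonneg hα hl.le
  have h2 : 0 ≤ 1 / 2 * B.σ ^ 2 * l ^ 2 := by positivity
  unfold ψ at h ⊢
  have hα0 : B.α = 0 := (mul_eq_zero.1 (by linarith : B.α * l = 0)).resolve_right hl.ne'
  have hσ0 : 1 / 2 * B.σ ^ 2 = 0 :=
    (mul_eq_zero.1 (by linarith : 1 / 2 * B.σ ^ 2 * l ^ 2 = 0)).resolve_right (by positivity)
  have hI : ∫ r in Ioi (0 : ℝ), (Real.exp (-l * r) - 1 + l * r) ∂B.π = 0 := by linarith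
  rw [setIntegral_eq_zero_iff_of_nonneg_ae
    ((ae_restrict_mem measurableSet_Ioi).mono fun r hr => (hpos r hr).le)
    (B.integrableOn_exp_sub_one_add hl.le)] at hI
  have hF : ∀ᵐ r ∂B.π.restrict (Ioi 0), False := by
    filter_upwards [hI, ae_restrict_mem measurableSet_Ioi] with r h hr using (hpos r hr).ne' h
  rw [hα0, hσ0, integral_eq_zero_of_ae (hF.mono fun r hr => hr.elim)]
  simp

/-- A zero of `ψ` would force `ψ = 0` everywhere, and with `1/0 = ∞` Grey's integral would diverge.
-/
theorem GreyCondition.ψ_pos (hα : 0 ≤ B.α) (hG : B.GreyCondition) {l : ℝ} (hl : 0 < l) :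
    0 < B.ψ l := by
  refine (ψ_nonneg hα hl.le).lt_of_ne fun h => ?_
  obtain ⟨c, -, hc⟩ := hG
  simp [ψ_eq_zero_of_eq_zero hα hl h.symm] at hc

/-! ### Reduction of the integral over `(0,∞)` to its behaviour near zero -/

theorem lintegral_Ioi_one_sub_exp_div_ψ_lt_top_iff (hα : 0 ≤ B.α) (hG : B.GreyCondition)
    {x : ℝ} (hx : 0 < x) :
    ∫⁻ v in Ioi (0 : ℝ), ENNReal.ofReal (1 - Real.exp (-x * v)) / ENNReal.ofReal (B.ψ v) < ⊤ ↔
      B.SmallIntegralFinite := by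
  constructor
  · intro h
    refine ⟨1, one_pos, ?_⟩
    -- On `(0,1)`, `1 - e^{-xu} ≥ x u e^{-xu} ≥ x u e^{-x}`, that is `u ≤ K (1 - e^{-xu})`.
    set K : ℝ := Real.exp x / x with hK
    have hle : ∫⁻ u in Ioo (0 : ℝ) 1, ENNReal.ofReal u / ENNReal.ofReal (B.ψ u) ≤
        ∫⁻ u in Ioo (0 : ℝ) 1, ENNReal.ofReal K *
          (ENNReal.ofReal (1 - Real.exp (-x * u)) / ENNReal.ofReal (B.ψ u)) := by
      refine setLIntegral_mono' measurableSet_Ioo fun u hu => ?_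
      rw [← mul_div_assoc, ← ENNReal.ofReal_mul (by positivity)]
      gcongr
      rw [hK, div_mul_eq_mul_div, le_div_iff₀ hx]
      have h1 : x * u * Real.exp (-x * u) ≤ 1 - Real.exp (-x * u) := by
        have h4 : 1 + x * u ≤ Real.exp (x * u) := by linarith [Real.add_one_le_exp (x * u)]
        have h5 : Real.exp (-x * u) * (1 + x * u) ≤ 1 := by
          calc Real.exp (-x * u) * (1 + x * u) ≤ Real.exp (-x * u) * Real.exp (x * u) := by gcongr
            _ = 1 := by rw [← Real.exp_add]; simp
        linarith
      have h2 : 1 ≤ Real.exp x * Real.exp (-x * u) := by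
        rw [← Real.exp_add]
        exact Real.one_le_exp (by nlinarith [hu.2])
      calc u * x = x * u * 1 := by ring
        _ ≤ x * u * (Real.exp x * Real.exp (-x * u)) := by
          have := mul_pos hx hu.1
          gcongr
        _ = Real.exp x * (x * u * Real.exp (-x * u)) := by ring
        _ ≤ _ := by gcongr
    refine hle.trans_lt ?_
    rw [lintegral_const_mul' _ _ ENNReal.ofReal_ne_top]
    exact ENNReal.mul_lt_top ENNReal.ofReal_lt_top
      ((lintegral_mono_set Ioo_subset_Ioi_self).trans_lt h)
  · rintro ⟨c, hc, hcI⟩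
    have hψ := hG.ψ_pos hα hc
    obtain ⟨d, -, hdI⟩ := hG
    have hsub : Ioi (0 : ℝ) ⊆ Ioo 0 c ∪ (Icc c d ∪ Ioi d) := by
      intro v (hv : 0 < v)
      rcases lt_or_ge v c with h | h
      · exact Or.inl ⟨hv, h⟩
      · exact Or.inr ((le_or_gt v d).imp (fun h' => ⟨h, h'⟩) id)
    refine (lintegral_mono_set hsub).trans_lt <| (lintegral_union_le _ _ _).trans_lt <|
      ENNReal.add_lt_top.2 ⟨?_, (lintegral_union_le _ _ _).trans_lt <|
        ENNReal.add_lt_top.2 ⟨?_, ?_⟩⟩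
    · have hle : ∫⁻ v in Ioo (0 : ℝ) c,
            ENNReal.ofReal (1 - Real.exp (-x * v)) / ENNReal.ofReal (B.ψ v) ≤
          ∫⁻ v in Ioo (0 : ℝ) c,
            ENNReal.ofReal x * (ENNReal.ofReal v / ENNReal.ofReal (B.ψ v)) := by
        refine setLIntegral_mono' measurableSet_Ioo fun u hu => ?_
        rw [← mul_div_assoc, ← ENNReal.ofReal_mul hx.le]
        gcongr
        linarith [Real.add_one_le_exp (-x * u)]
      refine hle.trans_lt ?_
      rw [lintegral_const_mul' _ _ ENNReal.ofReal_ne_top]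
      exact ENNReal.mul_lt_top ENNReal.ofReal_lt_top hcI
    · have hle : ∫⁻ v in Icc c d,
            ENNReal.ofReal (1 - Real.exp (-x * v)) / ENNReal.ofReal (B.ψ v) ≤
          ∫⁻ _ in Icc c d, (ENNReal.ofReal (B.ψ c))⁻¹ := by
        refine setLIntegral_mono' measurableSet_Icc fun u hu => ?_
        rw [← one_div]
        refine ENNReal.div_le_div (ENNReal.ofReal_le_one.2 ?_) (ENNReal.ofReal_le_ofReal
          (ψ_monotoneOn hα hc.le (hc.le.trans hu.1) hu.1))
        linarith [Real.exp_pos (-x * u)]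
      refine hle.trans_lt ?_
      rw [setLIntegral_const]
      exact ENNReal.mul_lt_top (ENNReal.inv_lt_top.2 (ENNReal.ofReal_pos.2 hψ))
        measure_Icc_lt_top
    · refine (lintegral_mono fun u => ?_).trans_lt hdI
      rw [← one_div]
      gcongr
      exact ENNReal.ofReal_le_one.2 (by linarith [Real.exp_pos (-x * u)])

/-! ### The flow `t ↦ u_t(l)` and its change of variables -/

namespace IsLogLaplace

variable {u : ℝ → ℝ → ℝ} (hu : B.IsLogLaplace u) {l : ℝ}
include hu

theorem continuousOn (hl : 0 < l) : ContinuousOn (fun t => u t l) (Ici 0) :=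
  fun t ht => (hu.ode l hl t ht).continuousWithinAt

theorem hasDerivAt (hl : 0 < l) {t : ℝ} (ht : 0 < t) :
    HasDerivAt (fun s => u s l) (-B.ψ (u t l)) t :=
  (hu.ode l hl t ht.le).hasDerivAt (Ici_mem_nhds ht)

theorem antitoneOn (hα : 0 ≤ B.α) (hl : 0 < l) : AntitoneOn (fun t => u t l) (Ici 0) := by
  refine antitoneOn_of_deriv_nonpos (convex_Ici 0) (hu.continuousOn hl) ?_ ?_ <;>
    rw [interior_Ici]
  · exact fun t ht => (hu.hasDerivAt hl ht).differentiableAt.differentiableWithinAt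
  · intro t (ht : 0 < t)
    rw [(hu.hasDerivAt hl ht).deriv]
    exact neg_nonpos.2 (ψ_nonneg hα (hu.nonneg l hl t ht.le))

theorem strictAntiOn (hα : 0 ≤ B.α) (hG : B.GreyCondition) (hl : 0 < l) :
    StrictAntiOn (fun t => u t l) {t | 0 ≤ t ∧ 0 < u t l} := by
  have hconv : Convex ℝ {t | 0 ≤ t ∧ 0 < u t l} := by
    refine OrdConnected.convex ⟨fun a ha b hb t ht => ?_⟩
    have h0 : 0 ≤ t := ha.1.trans ht.1
    exact ⟨h0, hb.2.trans_le (hu.antitoneOn hα hl h0 hb.1 ht.2)⟩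
  refine strictAntiOn_of_deriv_neg hconv ((hu.continuousOn hl).mono fun t ht => ht.1) ?_
  intro t ht
  have h0 : 0 < t := by
    have hsub : {t | 0 ≤ t ∧ 0 < u t l} ⊆ Ici 0 := fun t ht => ht.1
    exact mem_Ioi.1 (interior_Ici (a := (0 : ℝ)) ▸ interior_mono hsub ht)
  rw [(hu.hasDerivAt hl h0).deriv]
  exact neg_neg_of_pos (hG.ψ_pos hα (interior_subset ht).2)

/-- The flow `t ↦ u_t(l)` gets below every positive level. -/
theorem exists_lt (hα : 0 ≤ B.α) (hG : B.GreyCondition) (hl : 0 < l) {m : ℝ} (hm : 0 < m) :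
    ∃ t, 0 ≤ t ∧ u t l < m := by
  by_contra! h
  have hψ := hG.ψ_pos hα hm
  -- While the flow stays above `m` it descends at speed at least `ψ(m)`, so by time `l / ψ(m)` it
  -- would be at most `0 < m`.
  have hanti : AntitoneOn (fun t => u t l + B.ψ m * t) (Ici 0) := by
    refine antitoneOn_of_deriv_nonpos (convex_Ici 0)
      ((hu.continuousOn hl).add (by fun_prop)) ?_ ?_ <;> rw [interior_Ici]
    · exact fun t ht => ((hu.hasDerivAt hl ht).add
        ((hasDerivAt_id t).const_mul (B.ψ m))).differentiableAt.differentiableWithinAt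
    · intro t (ht : 0 < t)
      have hd := (hu.hasDerivAt hl ht).add ((hasDerivAt_id t).const_mul (B.ψ m))
      have hmono := ψ_monotoneOn hα hm.le (hm.le.trans (h t ht.le)) (h t ht.le)
      refine (hd.deriv.trans_le ?_ :)
      linarith
  have ht : 0 ≤ l / B.ψ m := by positivity
  have h1 := hanti self_mem_Ici ht ht
  simp only [hu.init l hl, mul_zero, add_zero, mul_div_cancel₀ l hψ.ne'] at h1
  linarith [h _ ht]

/-- The flow maps the positive times before it reaches `0` onto `(0, l)`. -/
theorem image_eq (hα : 0 ≤ B.α) (hG : B.GreyCondition) (hl : 0 < l) :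
    (fun t => u t l) '' {t | 0 < t ∧ 0 < u t l} = Ioo 0 l := by
  ext v
  constructor
  · rintro ⟨t, ⟨ht, hpos⟩, rfl⟩
    refine ⟨hpos, ?_⟩
    have h0 : 0 < u 0 l := (hu.init l hl).symm ▸ hl
    have := hu.strictAntiOn hα hG hl ⟨le_rfl, h0⟩ ⟨ht.le, hpos⟩ ht
    simpa only [hu.init l hl] using this
  · rintro ⟨hv, hvl⟩
    obtain ⟨T, hT, huT⟩ := hu.exists_lt hα hG hl hv
    obtain ⟨t, ht, rfl⟩ := intermediate_value_Icc' hT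
      ((hu.continuousOn hl).mono Icc_subset_Ici_self)
      ⟨huT.le, by simpa only [hu.init l hl] using hvl.le⟩
    refine ⟨t, ⟨ht.1.lt_of_ne ?_, hv⟩, rfl⟩
    rintro rfl
    exact hvl.ne (hu.init l hl)

/-- Change of variables along the flow `∂u_t(l)/∂t = -ψ(u_t(l))`. -/
theorem lintegral_comp (hα : 0 ≤ B.α) (hG : B.GreyCondition) (hl : 0 < l)
    {f : ℝ → ℝ≥0∞} (hf : f 0 = 0) :
    ∫⁻ t in Ioi (0 : ℝ), f (u t l) =
      ∫⁻ v in Ioo 0 l, f v / ENNReal.ofReal (B.ψ v) := by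
  have hsm : MeasurableSet {t | 0 < t ∧ 0 < u t l} := by
    have hc : ContinuousOn (fun t => u t l) (Ioi 0) :=
      (hu.continuousOn hl).mono Ioi_subset_Ici_self
    exact (hc.isOpen_inter_preimage isOpen_Ioi isOpen_Ioi).measurableSet
  have hinj : InjOn (fun t => u t l) {t | 0 < t ∧ 0 < u t l} :=
    fun s hs t ht => (hu.strictAntiOn hα hG hl).injOn ⟨hs.1.le, hs.2⟩ ⟨ht.1.le, ht.2⟩
  rw [← hu.image_eq hα hG hl, lintegral_image_eq_lintegral_abs_deriv_mul hsm
    (fun t ht => (hu.hasDerivAt hl ht.1).hasDerivWithinAt) hinj]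
  have hcongr : ∫⁻ t in {t | 0 < t ∧ 0 < u t l}, ENNReal.ofReal |(-B.ψ (u t l))| *
        (f (u t l) / ENNReal.ofReal (B.ψ (u t l))) =
      ∫⁻ t in {t | 0 < t ∧ 0 < u t l}, f (u t l) := by
    refine setLIntegral_congr_fun hsm fun t ht => ?_
    have hψ := hG.ψ_pos hα ht.2
    simp only [abs_neg, abs_of_pos hψ]
    exact ENNReal.mul_div_cancel (ENNReal.ofReal_pos.2 hψ).ne' ENNReal.ofReal_ne_top
  rw [hcongr]
  have hsub : {t | 0 < t ∧ 0 < u t l} ⊆ Ioi 0 := fun t ht => ht.1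
  -- Times at which the flow is at `0` contribute nothing because `f 0 = 0`; whether it ever reaches
  -- `0` need not be decided.
  rw [← inter_eq_self_of_subset_left hsub, ← setLIntegral_indicator hsm]
  refine setLIntegral_congr_fun measurableSet_Ioi fun t (ht : 0 < t) => ?_
  by_cases hpos : 0 < u t l
  · have hmem : t ∈ {t | 0 < t ∧ 0 < u t l} := ⟨ht, hpos⟩
    rw [indicator_of_mem hmem]
  have hnot : t ∉ {t | 0 < t ∧ 0 < u t l} := fun h => hpos h.2
  have h0 : u t l = 0 := le_antisymm (not_lt.1 hpos) (hu.nonneg l hl t ht.le)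
  rw [indicator_of_notMem hnot, h0, hf]

end IsLogLaplace

end BranchingMechanism

/-! ### Extinction time and total mass of the potential measure -/

namespace CBProcess

variable {B : BranchingMechanism} {Ω : Type*} [MeasurableSpace Ω] (C : CBProcess B Ω)

theorem potentialMeasure_univ (x : ℝ≥0) :
    C.potentialMeasure x univ = ∫⁻ t in Ioi (0 : ℝ), C.P x {ω | C.Z t.toNNReal ω ∈ Ioi 0} := by
  rw [C.potentialMeasure_apply x MeasurableSet.univ, image_univ, Subtype.range_coe]

/-- If `0` is absorbing, the extinction time is the time spent in `(0, ∞)`. -/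
theorem extinctionTime_eq_volume {ω : Ω}
    (h : ∀ s t, s ≤ t → C.Z s ω = 0 → C.Z t ω = 0) :
    C.extinctionTime ω = volume {t : ℝ | 0 < t ∧ C.Z t.toNNReal ω ∈ Ioi 0} := by
  -- The set of positive times with `Z > 0` lies between `(0, ζ)` and `(0, ζ]`, so the value at `ζ`
  -- itself is irrelevant.
  have hlow : {t : ℝ | 0 < t ∧ ENNReal.ofReal t < C.extinctionTime ω} ⊆
      {t : ℝ | 0 < t ∧ C.Z t.toNNReal ω ∈ Ioi 0} := by
    rintro t ⟨ht, htζ⟩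
    refine ⟨ht, mem_Ioi.2 (pos_of_ne_zero fun h0 => htζ.not_ge ?_)⟩
    exact iInf₂_le t.toNNReal ⟨Real.toNNReal_pos.2 ht, h0⟩
  have hupp : {t : ℝ | 0 < t ∧ C.Z t.toNNReal ω ∈ Ioi 0} ⊆
      {t : ℝ | 0 < t ∧ ENNReal.ofReal t ≤ C.extinctionTime ω} := by
    rintro t ⟨ht, hZ⟩
    refine ⟨ht, le_iInf₂ fun s hs => ENNReal.coe_le_coe.2 (le_of_not_gt fun hst => ?_)⟩
    exact (ne_of_gt hZ) (h s _ hst.le hs.2)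
  by_cases htop : C.extinctionTime ω = ⊤
  · rw [htop] at hlow ⊢
    refine (top_le_iff.1 ?_).symm
    calc (⊤ : ℝ≥0∞) = volume (Ioi (0 : ℝ)) := Real.volume_Ioi.symm
      _ ≤ _ := measure_mono fun t ht => hlow ⟨ht, ENNReal.ofReal_lt_top⟩
  · refine le_antisymm ?_ ?_
    · calc C.extinctionTime ω = volume (Ioo 0 (C.extinctionTime ω).toReal) := by
            rw [Real.volume_Ioo, sub_zero, ENNReal.ofReal_toReal htop]
        _ ≤ _ := measure_mono fun t ht =>
            hlow ⟨ht.1, (ENNReal.ofReal_lt_iff_lt_toReal ht.1.le htop).2 ht.2⟩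
    · calc _ ≤ volume (Ioc 0 (C.extinctionTime ω).toReal) := measure_mono fun t ht =>
            ⟨ht.1, (ENNReal.ofReal_le_iff_le_toReal htop).1 (hupp ht).2⟩
        _ = C.extinctionTime ω := by
            rw [Real.volume_Ioc, sub_zero, ENNReal.ofReal_toReal htop]

/-- The expected extinction time is the total mass of the potential measure. -/
theorem expectedExtinctionTime_eq_potentialMeasure_univ (x : ℝ≥0) :
    C.expectedExtinctionTime x = C.potentialMeasure x univ := by
  have := C.isMarkovKernel
  have hS : MeasurableSet {p : ℝ × Ω | C.Z p.1.toNNReal p.2 ∈ Ioi 0} :=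
    (C.measurable_uncurry.comp
      ((measurable_real_toNNReal.comp measurable_fst).prodMk measurable_snd)) measurableSet_Ioi
  have hζ : C.expectedExtinctionTime x = ∫⁻ ω, (volume.restrict (Ioi (0 : ℝ)))
      ((fun t => (t, ω)) ⁻¹' {p : ℝ × Ω | C.Z p.1.toNNReal p.2 ∈ Ioi 0}) ∂C.P x := by
    refine lintegral_congr_ae ((C.absorbing x).mono fun ω hω => ?_)
    simp only
    rw [C.extinctionTime_eq_volume hω, Measure.restrict_apply (measurable_prodMk_right hS),
      inter_comm]
    rfl
  rw [hζ, C.potentialMeasure_univ, ← Measure.prod_apply_symm hS, Measure.prod_apply hS]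
  rfl

theorem lintegral_one_sub_exp {u : ℝ → ℝ → ℝ} (x t : ℝ≥0) {l : ℝ} (hl : 0 < l)
    (h : ∫ ω, Real.exp (-l * (C.Z t ω : ℝ)) ∂C.P x = Real.exp (-(x : ℝ) * u t l)) :
    ∫⁻ ω, ENNReal.ofReal (1 - Real.exp (-l * (C.Z t ω : ℝ))) ∂C.P x =
      ENNReal.ofReal (1 - Real.exp (-(x : ℝ) * u t l)) := by
  have := C.isMarkovKernel
  have hle : ∀ ω, Real.exp (-l * (C.Z t ω : ℝ)) ≤ 1 := fun ω => Real.exp_le_one_iff.2 <| by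
    nlinarith [mul_nonneg hl.le (C.Z t ω).coe_nonneg]
  have hm : Measurable fun ω => Real.exp (-l * (C.Z t ω : ℝ)) := by
    have := C.measurable_Z t
    fun_prop
  have hint : Integrable (fun ω => Real.exp (-l * (C.Z t ω : ℝ))) (C.P x) :=
    (integrable_const (1 : ℝ)).mono' hm.aestronglyMeasurable <| Eventually.of_forall fun ω => by
      rw [Real.norm_of_nonneg (Real.exp_pos _).le]; exact hle ω
  rw [← ofReal_integral_eq_lintegral_ofReal (f := fun ω => 1 - Real.exp (-l * (C.Z t ω : ℝ)))
    ((integrable_const 1).sub hint) (Eventually.of_forall fun ω => sub_nonneg.2 (hle ω)),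
    integral_sub (integrable_const 1) hint, h]
  simp

theorem iSup_ofReal_one_sub_exp (z : ℝ≥0) :
    ⨆ n : ℕ, ENNReal.ofReal (1 - Real.exp (-((n : ℝ) + 1) * z)) =
      (Ioi (0 : ℝ≥0)).indicator 1 z := by
  rcases eq_or_ne z 0 with rfl | hz
  · simp
  have hz' : 0 < z := pos_of_ne_zero hz
  rw [indicator_of_mem (mem_Ioi.2 hz')]
  refine iSup_eq_of_tendsto ?_ ?_
  · intro m n hmn
    dsimp only
    gcongr
  · have h1 : Tendsto (fun n : ℕ => ((n : ℝ) + 1) * z) atTop atTop :=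
      (tendsto_natCast_atTop_atTop.atTop_add tendsto_const_nhds).atTop_mul_const
        (NNReal.coe_pos.2 hz')
    have h2 := (Real.tendsto_exp_neg_atTop_nhds_zero.comp h1).const_sub 1
    simpa only [Function.comp_def, neg_mul, sub_zero, ENNReal.ofReal_one, Pi.one_apply] using
      ENNReal.tendsto_ofReal h2

theorem monotone_ofReal_one_sub_exp (z : ℝ≥0) :
    Monotone fun n : ℕ => ENNReal.ofReal (1 - Real.exp (-((n : ℝ) + 1) * z)) := by
  intro m n hmn
  dsimp only
  gcongr

/-- The total mass of the potential measure is `∫_0^∞ (1 - e^{-x v}) / ψ(v) dv`. -/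
theorem potentialMeasure_univ_eq (hα : 0 ≤ B.α) (hG : B.GreyCondition) (x : ℝ≥0) :
    C.potentialMeasure x univ = ∫⁻ v in Ioi (0 : ℝ),
      ENNReal.ofReal (1 - Real.exp (-(x : ℝ) * v)) / ENNReal.ofReal (B.ψ v) := by
  obtain ⟨u, hu, hlap⟩ := C.laplace
  have hn : ∀ n : ℕ, (0 : ℝ) < n + 1 := fun n => by positivity
  have hL : ∀ (n : ℕ) (t : ℝ), 0 < t → ENNReal.ofReal (1 - Real.exp (-(x : ℝ) * u t (n + 1))) =
      ∫⁻ ω, ENNReal.ofReal (1 - Real.exp (-((n : ℝ) + 1) * (C.Z t.toNNReal ω : ℝ))) ∂C.P x := by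
    intro n t ht
    rw [C.lintegral_one_sub_exp x _ (hn n) (hlap x _ _ (hn n)), Real.coe_toNNReal t ht.le]
  have hmeas : ∀ (t : ℝ≥0) (n : ℕ), Measurable fun ω =>
      ENNReal.ofReal (1 - Real.exp (-((n : ℝ) + 1) * (C.Z t ω : ℝ))) := fun t n => by
    have := C.measurable_Z t
    fun_prop
  have hP : ∀ t : ℝ, 0 < t → C.P x {ω | C.Z t.toNNReal ω ∈ Ioi 0} =
      ⨆ n : ℕ, ENNReal.ofReal (1 - Real.exp (-(x : ℝ) * u t (n + 1))) := by
    intro t ht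
    simp_rw [hL _ t ht]
    rw [← lintegral_iSup (hmeas _) fun m n hmn ω => monotone_ofReal_one_sub_exp _ hmn]
    simp_rw [iSup_ofReal_one_sub_exp]
    exact (lintegral_indicator_one (C.measurable_Z _ measurableSet_Ioi)).symm
  rw [C.potentialMeasure_univ, setLIntegral_congr_fun measurableSet_Ioi fun t ht => hP t ht,
    lintegral_iSup']
  · have hflow : ∀ n : ℕ, ∫⁻ t in Ioi (0 : ℝ),
          ENNReal.ofReal (1 - Real.exp (-(x : ℝ) * u t (n + 1))) =
        ∫⁻ v in Ioo 0 ((n : ℝ) + 1),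
          ENNReal.ofReal (1 - Real.exp (-(x : ℝ) * v)) / ENNReal.ofReal (B.ψ v) := fun n =>
      hu.lintegral_comp hα hG (hn n)
        (f := fun v => ENNReal.ofReal (1 - Real.exp (-(x : ℝ) * v))) (by simp)
    have hU : ⋃ n : ℕ, Ioo (0 : ℝ) (n + 1) = Ioi 0 := by
      refine subset_antisymm (iUnion_subset fun n => Ioo_subset_Ioi_self) fun v hv => ?_
      obtain ⟨n, hvn⟩ := exists_nat_gt v
      exact mem_iUnion.2 ⟨n, hv, hvn.trans (lt_add_one _)⟩
    simp_rw [hflow]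
    rw [← hU, setLIntegral_iUnion_of_directed]
    exact Monotone.directed_le fun m n hmn => Ioo_subset_Ioo_right (by gcongr)
  · intro n
    have hc : ContinuousOn (fun t => u t ((n : ℝ) + 1)) (Ioi 0) :=
      (hu.continuousOn (hn n)).mono Ioi_subset_Ici_self
    exact (((hc.aemeasurable measurableSet_Ioi).const_mul _).exp.const_sub 1).ennreal_ofReal
  -- Monotonicity in `n` is read off the expectation of `1 - e^{-(n+1) Z_t}`, which avoids comparing
  -- solutions of the ODE.
  · refine (ae_restrict_mem measurableSet_Ioi).mono fun t ht m n hmn => ?_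
    simp only [hL _ t ht]
    exact lintegral_mono fun ω => monotone_ofReal_one_sub_exp _ hmn

theorem isFiniteMeasure_potentialMeasure_iff (hα : 0 ≤ B.α) (hG : B.GreyCondition) {x : ℝ≥0}
    (hx : 0 < x) : IsFiniteMeasure (C.potentialMeasure x) ↔ B.SmallIntegralFinite := by
  rw [isFiniteMeasure_iff, C.potentialMeasure_univ_eq hα hG,
    BranchingMechanism.lintegral_Ioi_one_sub_exp_div_ψ_lt_top_iff hα hG (NNReal.coe_pos.2 hx)]

theorem expectedExtinctionTime_lt_top_iff (hα : 0 ≤ B.α) (hG : B.GreyCondition) {x : ℝ≥0}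
    (hx : 0 < x) : C.expectedExtinctionTime x < ⊤ ↔ B.SmallIntegralFinite := by
  rw [C.expectedExtinctionTime_eq_potentialMeasure_univ, ← isFiniteMeasure_iff,
    C.isFiniteMeasure_potentialMeasure_iff hα hG hx]

end CBProcess

theorem mainTheorem9 (B : BranchingMechanism) (hα : 0 ≤ B.α) (hGrey : B.GreyCondition)
    {Ω : Type*} [MeasurableSpace Ω] (C : CBProcess B Ω) :
    List.TFAE
      [∃ x : ℝ≥0, 0 < x ∧ IsFiniteMeasure (C.potentialMeasure x),
        ∀ x : ℝ≥0, 0 < x → IsFiniteMeasure (C.potentialMeasure x),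
        ∃ x : ℝ≥0, 0 < x ∧ C.expectedExtinctionTime x < ⊤,
        ∀ x : ℝ≥0, 0 < x → C.expectedExtinctionTime x < ⊤,
        B.SmallIntegralFinite] := by
  have hfin : ∀ x : ℝ≥0, 0 < x →
      (IsFiniteMeasure (C.potentialMeasure x) ↔ B.SmallIntegralFinite) :=
    fun x hx => C.isFiniteMeasure_potentialMeasure_iff hα hGrey hx
  have hext : ∀ x : ℝ≥0, 0 < x →
      (C.expectedExtinctionTime x < ⊤ ↔ B.SmallIntegralFinite) :=
    fun x hx => C.expectedExtinctionTime_lt_top_iff hα hGrey hx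
  tfae_have 1 → 5 := fun ⟨x, hx, h⟩ => (hfin x hx).1 h
  tfae_have 5 → 2 := fun h x hx => (hfin x hx).2 h
  tfae_have 2 → 1 := fun h => ⟨1, one_pos, h 1 one_pos⟩
  tfae_have 3 → 5 := fun ⟨x, hx, h⟩ => (hext x hx).1 h
  tfae_have 5 → 4 := fun h x hx => (hext x hx).2 h
  tfae_have 4 → 3 := fun h => ⟨1, one_pos, h 1 one_pos⟩
  tfae_finish
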